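/- For integers $n_1,n_2,n_3\ge 1$ let $$L_3(n_1,n_2,n_3)=\{s,\,a_{1,1},\dots,a_{1,n_1},\,a_{2,1},\dots,a_{2,n_2},\,a_{3,1},\dots,a_{3,n_3},\,t\}$$ be the finite lattice with $s<a_{i,1}<a_{i,2}<\cdots<a_{i,n_i}<t$ for $i=1,2,3$, in which elements $a_{i,j}$ and $a_{i',j'}$ with $i\ne i'$ are incomparable. For a field $K$ and a finite lattice $L$, let $K[L]$ be the polynomial ring over $K$ with one variable $x_a$ for each $a\in L$, and let $$I_L=\bigl(x_ax_b-x_{a\vee b}\,x_{a\wedge b}\ :\ a,b\in L\bigr)\subset K[L]$$ be the join-meet ideal of $L$. Theorem. Let $K$ be any field and suppose that one of the following holds: 1. $(n_1,n_2,n_3)=(k,1,1)$ with $2\le k\le 10$; 2. $(n_1,n_2,n_3)=(k,k',1)$ with $2\le k,k'\le 4$; 3. $(n_1,n_2,n_3)=(k,k',k'')$ with $2\le k,k',k''\le 3$. Then the join-meet ideal $I_{L_3(n_1,n_2,n_3)}$ is a radical ideal of $K[L_3(n_1,n_2,n_3)]$. -/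

import Mathlib

/-- The join-meet ideal of a lattice `L` over `K`: the ideal of the polynomial ring `K[L]`
(one variable `x_a` for each element `a` of `L`) generated by all
`x_a x_b - x_{a ⊔ b} x_{a ⊓ b}` with `a, b ∈ L`. -/
noncomputable def joinMeetIdeal (K : Type*) [CommRing K] (L : Type*) [Lattice L] :
    Ideal (MvPolynomial L K) :=
  Ideal.span {f | ∃ a b : L, f =
    MvPolynomial.X a * MvPolynomial.X b - MvPolynomial.X (a ⊔ b) * MvPolynomial.X (a ⊓ b)}

/-- The underlying set `{s, a_{1,1}, …, a_{1,n_1}, …, a_{k,1}, …, a_{k,n_k}, t}` of the lattice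
`L_k(n_1, …, n_k)`. The indices `i` and `j` of `a i j` are counted from `0`. -/
inductive ChainLattice {k : ℕ} (n : Fin k → ℕ) : Type
  | s : ChainLattice n
  | a (i : Fin k) (j : Fin (n i)) : ChainLattice n
  | t : ChainLattice n

namespace ChainLattice

variable {k : ℕ} {n : Fin k → ℕ}

/-- The order relation: `s` is the least element, `t` is the greatest element, each of the `k`
sequences `a i 0, a i 1, …` is an increasing chain, and elements of different chains are
incomparable. -/
def le : ChainLattice n → ChainLattice n → Prop
  | s, _ => True
  | _, t => True
  | a i j, a i' j' => i = i' ∧ (j : ℕ) ≤ (j' : ℕ)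
  | _, _ => False

instance : PartialOrder (ChainLattice n) where
  le := le
  le_refl x := by cases x <;> simp [le]
  le_trans x y z := by
    cases x <;> cases y <;> cases z <;> simp [le]
    intro h1 h2 h3 h4
    exact ⟨h1.trans h3, h2.trans h4⟩
  le_antisymm x y := by
    cases x <;> cases y <;> simp [le]
    rintro rfl h1 - h2
    exact ⟨rfl, heq_of_eq (Fin.ext (le_antisymm h1 h2))⟩

theorem le_def (x y : ChainLattice n) : x ≤ y ↔ le x y := Iff.rfl

theorem s_le (x : ChainLattice n) : s ≤ x := by cases x <;> simp [le_def, le]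

theorem le_t (x : ChainLattice n) : x ≤ t := by cases x <;> simp [le_def, le]

/-- Two incomparable elements have no common upper bound except `t`. -/
theorem eq_t_of_le {x y z : ChainLattice n} (hxy : ¬ x ≤ y) (hyx : ¬ y ≤ x)
    (hx : x ≤ z) (hy : y ≤ z) : z = t := by
  rw [le_def] at *
  cases x <;> cases y <;> cases z <;> simp only [le] at * <;> grind

/-- Two incomparable elements have no common lower bound except `s`. -/
theorem eq_s_of_le {x y z : ChainLattice n} (hxy : ¬ x ≤ y) (hyx : ¬ y ≤ x)
    (hx : z ≤ x) (hy : z ≤ y) : z = s := by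
  rw [le_def] at *
  cases x <;> cases y <;> cases z <;> simp only [le] at * <;> grind

open Classical in
/-- The lattice structure belonging to the order: the join of two comparable elements is the larger
one and that of two incomparable elements is `t`; the meet of two comparable elements is the smaller
one and that of two incomparable elements is `s`. -/
noncomputable instance : Lattice (ChainLattice n) where
  sup x y := if x ≤ y then y else if y ≤ x then x else t
  inf x y := if x ≤ y then x else if y ≤ x then y else s
  le_sup_left x y := by
    split_ifs with h1 h2
    · exact h1
    · exact le_refl x
    · exact le_t x
  le_sup_right x y := by
    split_ifs with h1 h2
    · exact le_refl y
    · exact h2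
    · exact le_t y
  sup_le x y z hx hy := by
    split_ifs with h1 h2
    · exact hy
    · exact hx
    · exact (eq_t_of_le h1 h2 hx hy).ge
  inf_le_left x y := by
    split_ifs with h1 h2
    · exact le_refl x
    · exact h2
    · exact s_le x
  inf_le_right x y := by
    split_ifs with h1 h2
    · exact h1
    · exact le_refl y
    · exact s_le y
  le_inf x y z hx hy := by
    split_ifs with h1 h2
    · exact hx
    · exact hy
    · exact (eq_s_of_le h1 h2 hx hy).le

end ChainLattice

/-! Let I be the join-meet ideal. Comparable pairs contribute nothing, so I is generated by the x_a
x_b - x_s x_t with a, b on different chains. Its zero set is a surface, the image of `param`,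
together with the coordinate subspaces cut out by the sets `offChain b i`, b = s or t. The
corresponding maps `param` and `killVars` go to domains and vanish on I, so they vanish on any f
with a power in I. Two facts then put f in I. The `killVars` conditions give f = g + x_s x_t h with
g in I (`mem_sup_of_killVars_eq_zero`). Applying `param` yields `param` h = 0, and x_s x_t times the
kernel of `param` lies in I (`mul_mem_of_param_eq_zero`). The latter rests on a third chain: modulo
I, x_s x_t makes all chain variables equal. -/

namespace MvPolynomial

/-! ### Killing variables, and parity of exponents -/

variable {σ R : Type*} [CommRing R]

/-- The endomorphism of the polynomial ring that sends the variables in `A` to `0` and fixes the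
other variables. -/
noncomputable def killVars (R : Type*) [CommRing R] (A : Set σ) :
    MvPolynomial σ R →ₐ[R] MvPolynomial σ R :=
  open Classical in aeval fun x => if x ∈ A then 0 else X x

theorem killVars_X_of_mem {A : Set σ} {x : σ} (h : x ∈ A) : killVars R A (X x) = 0 := by
  simp [killVars, h]

theorem killVars_X_of_notMem {A : Set σ} {x : σ} (h : x ∉ A) : killVars R A (X x) = X x := by
  simp [killVars, h]

theorem sub_killVars_mem_span (A : Set σ) (f : MvPolynomial σ R) :
    f - killVars R A f ∈ Ideal.span (X '' A : Set (MvPolynomial σ R)) := by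
  induction f using MvPolynomial.induction_on with
  | C r => simp [killVars, algebraMap_eq]
  | add f g hf hg =>
    rw [map_add, add_sub_add_comm]
    exact add_mem hf hg
  | mul_X f x hf =>
    rw [map_mul]
    by_cases hx : x ∈ A
    · rw [killVars_X_of_mem hx, mul_zero, sub_zero]
      exact Ideal.mul_mem_left _ _ (Ideal.subset_span ⟨x, hx, rfl⟩)
    · rw [killVars_X_of_notMem hx, ← sub_mul]
      exact Ideal.mul_mem_right _ _ hf

theorem exists_mem_ne_zero_of_killVars_eq_zero {A : Set σ} {f : MvPolynomial σ R}
    (h : killVars R A f = 0) {m : σ →₀ ℕ} (hm : m ∈ f.support) : ∃ x ∈ A, m x ≠ 0 := by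
  have hf := sub_killVars_mem_span A f
  rw [h, sub_zero, mem_ideal_span_X_image] at hf
  exact hf m hm

/-- `1` and `x₀ x₁` are linearly independent over the subalgebra generated by `x₀²` and `x₁²`. -/
theorem eq_zero_of_expand_two_add_eq_zero {p q : MvPolynomial (Fin 2) R}
    (h : expand 2 p + X 0 * (X 1 * expand 2 q) = 0) : p = 0 ∧ q = 0 := by
  have hp : p = 0 := by
    ext m
    have hm := congrArg (coeff (2 • m)) h
    rw [coeff_add, coeff_expand_smul 2 two_ne_zero, coeff_X_mul', coeff_X_mul', coeff_zero] at hm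
    -- The exponent of `X 0` here is 2 * m 0 - 1, which is odd. For m 0 = 0 the subtraction
    -- truncates, but then `X 0` does not divide the monomial.
    have h0 : m 0 ≠ 0 → coeff (2 • m - Finsupp.single 0 1 - Finsupp.single 1 1) (expand 2 q) = 0 :=
      fun h0 => coeff_expand_of_not_dvd (i := 0) q (by
        simp only [Finsupp.coe_tsub, Finsupp.coe_smul, Pi.sub_apply, Pi.smul_apply, smul_eq_mul,
          Finsupp.single_eq_same, Finsupp.single_apply]
        simp
        omega)
    by_cases hm0 : m 0 = 0
    · simpa [hm0] using hm
    · simpa [h0 hm0] using hm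
  refine ⟨hp, ?_⟩
  rw [hp, map_zero, zero_add] at h
  ext m
  have hm := congrArg (coeff (Finsupp.single 0 1 + (Finsupp.single 1 1 + 2 • m))) h
  rwa [coeff_X_mul, coeff_X_mul, coeff_expand_smul 2 two_ne_zero] at hm

end MvPolynomial

namespace ChainLattice

open MvPolynomial

/-! ### Generators of the ideal -/

variable {k : ℕ} {n : Fin k → ℕ} {K : Type*} [Field K]

theorem not_a_le_a {i i' : Fin k} (h : i ≠ i') (j : Fin (n i)) (j' : Fin (n i')) :
    ¬ (a i j : ChainLattice n) ≤ a i' j' := by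
  rw [le_def]
  exact fun h' => h h'.1

theorem a_sup_a {i i' : Fin k} (h : i ≠ i') (j : Fin (n i)) (j' : Fin (n i')) :
    (a i j ⊔ a i' j' : ChainLattice n) = t :=
  eq_t_of_le (not_a_le_a h j j') (not_a_le_a h.symm j' j) le_sup_left le_sup_right

theorem a_inf_a {i i' : Fin k} (h : i ≠ i') (j : Fin (n i)) (j' : Fin (n i')) :
    (a i j ⊓ a i' j' : ChainLattice n) = s :=
  eq_s_of_le (not_a_le_a h j j') (not_a_le_a h.symm j' j) inf_le_left inf_le_right

theorem le_or_le_or_eq_a (x y : ChainLattice n) :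
    x ≤ y ∨ y ≤ x ∨ ∃ i i' j j', i ≠ i' ∧ x = a i j ∧ y = a i' j' := by
  cases x with
  | s => exact Or.inl (s_le _)
  | t => exact Or.inr (Or.inl (le_t _))
  | a i j =>
    cases y with
    | s => exact Or.inr (Or.inl (s_le _))
    | t => exact Or.inl (le_t _)
    | a i' j' =>
      by_cases h : i = i'
      · subst h
        rcases le_total (j : ℕ) j' with hj | hj
        · exact Or.inl ⟨rfl, hj⟩
        · exact Or.inr (Or.inl ⟨rfl, hj⟩)
      · exact Or.inr (Or.inr ⟨i, i', j, j', h, rfl, rfl⟩)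

theorem X_a_mul_X_a_sub_mem {i i' : Fin k} (h : i ≠ i') (j : Fin (n i)) (j' : Fin (n i')) :
    (X (a i j) * X (a i' j') - X s * X t : MvPolynomial (ChainLattice n) K) ∈
      joinMeetIdeal K (ChainLattice n) :=
  Ideal.subset_span ⟨a i j, a i' j', by rw [a_sup_a h, a_inf_a h, mul_comm (X t)]⟩

theorem joinMeetIdeal_le {J : Ideal (MvPolynomial (ChainLattice n) K)}
    (h : ∀ (i i' : Fin k) (j : Fin (n i)) (j' : Fin (n i')), i ≠ i' →
      X (a i j) * X (a i' j') - X s * X t ∈ J) :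
    joinMeetIdeal K (ChainLattice n) ≤ J := by
  refine Ideal.span_le.mpr ?_
  rintro _ ⟨x, y, rfl⟩
  rcases le_or_le_or_eq_a x y with hxy | hxy | ⟨i, i', j, j', hi, rfl, rfl⟩
  · rw [sup_of_le_right hxy, inf_of_le_left hxy, mul_comm, sub_self]
    exact J.zero_mem
  · rw [sup_of_le_left hxy, inf_of_le_right hxy, sub_self]
    exact J.zero_mem
  · rw [a_sup_a hi, a_inf_a hi, mul_comm (X t)]
    exact h i i' j j' hi

theorem _root_.Fin.exists_ne_and_ne (hk : 3 ≤ k) (i i' : Fin k) : ∃ l, l ≠ i ∧ l ≠ i' := by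
  obtain ⟨l, -, hl⟩ := Finset.exists_mem_notMem_of_card_lt_card
    (s := {i, i'}) (t := (Finset.univ : Finset (Fin k)))
    (lt_of_le_of_lt Finset.card_le_two (by rw [Finset.card_univ, Fintype.card_fin]; exact hk))
  exact ⟨l, by simpa using hl⟩

/-- With c on a third chain, x_c x_a x_a' reduces modulo the ideal both to x_s x_t x_a' and to x_s
x_t x_a. -/
theorem mul_X_a_sub_X_a_mem (hk : 3 ≤ k) (hn : ∀ i, 0 < n i) (i i' : Fin k)
    (j : Fin (n i)) (j' : Fin (n i')) :
    (X s * X t * (X (a i j) - X (a i' j')) : MvPolynomial (ChainLattice n) K) ∈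
      joinMeetIdeal K (ChainLattice n) := by
  obtain ⟨l, hl, hl'⟩ := Fin.exists_ne_and_ne hk i i'
  have h := X_a_mul_X_a_sub_mem (K := K) hl ⟨0, hn l⟩ j
  have h' := X_a_mul_X_a_sub_mem (K := K) hl' ⟨0, hn l⟩ j'
  convert sub_mem (Ideal.mul_mem_left _ (X (a i' j')) h)
    (Ideal.mul_mem_left _ (X (a i j)) h') using 1
  ring

/-! ### The component where x_s x_t does not vanish -/

/-- The parametrization `x_s = X₀²`, `x_t = X₁²`, `x_a = X₀ X₁` for all other `a`, of the component
of the zero set of the join-meet ideal on which `x_s x_t` does not vanish. -/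
noncomputable def param (K : Type*) [Field K] (n : Fin k → ℕ) :
    MvPolynomial (ChainLattice n) K →ₐ[K] MvPolynomial (Fin 2) K :=
  aeval fun
    | s => X 0 ^ 2
    | a _ _ => X 0 * X 1
    | t => X 1 ^ 2

@[simp] theorem param_X_s : param K n (X s) = X 0 ^ 2 := by simp [param]

@[simp] theorem param_X_t : param K n (X t) = X 1 ^ 2 := by simp [param]

@[simp] theorem param_X_a (i : Fin k) (j : Fin (n i)) : param K n (X (a i j)) = X 0 * X 1 := by
  simp [param]

theorem param_eq_zero_of_mem {f : MvPolynomial (ChainLattice n) K}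
    (hf : f ∈ joinMeetIdeal K (ChainLattice n)) : param K n f = 0 := by
  refine joinMeetIdeal_le (J := RingHom.ker (param K n)) (fun i i' j j' _ => ?_) hf
  rw [RingHom.mem_ker, map_sub, map_mul, map_mul, param_X_a, param_X_a, param_X_s, param_X_t]
  ring

theorem eq_zero_of_param_mul_eq_zero {f : MvPolynomial (ChainLattice n) K}
    (hf : param K n (X s * X t * f) = 0) : param K n f = 0 := by
  rw [map_mul, map_mul, param_X_s, param_X_t] at hf
  exact (mul_eq_zero.mp hf).resolve_left
    (mul_ne_zero (pow_ne_zero _ (X_ne_zero _)) (pow_ne_zero _ (X_ne_zero _)))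

/-- The inclusion of the polynomial ring in the variables `x_s` and `x_t`. -/
noncomputable def ofBounds (K : Type*) [Field K] (n : Fin k → ℕ) :
    MvPolynomial (Fin 2) K →ₐ[K] MvPolynomial (ChainLattice n) K :=
  aeval ![X s, X t]

theorem param_ofBounds (p : MvPolynomial (Fin 2) K) : param K n (ofBounds K n p) = expand 2 p := by
  have : (param K n).comp (ofBounds K n) = expand 2 := by
    ext i : 1
    fin_cases i <;> simp [ofBounds]
  exact DFunLike.congr_fun this p

/-- Up to multiplication by `x_s x_t`, each polynomial is congruent modulo the join-meet ideal to
one of the form `p + x_r q` with `p` and `q` polynomials in `x_s` and `x_t`. -/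
theorem exists_normal_form (hk : 3 ≤ k) (hn : ∀ i, 0 < n i) (i : Fin k) (j : Fin (n i))
    (f : MvPolynomial (ChainLattice n) K) :
    ∃ p q, X s * X t * (f - (ofBounds K n p + X (a i j) * ofBounds K n q)) ∈
      joinMeetIdeal K (ChainLattice n) := by
  induction f using MvPolynomial.induction_on with
  | C r => exact ⟨C r, 0, by simp [ofBounds, algebraMap_eq]⟩
  | add f g hf hg =>
    obtain ⟨p, q, h⟩ := hf
    obtain ⟨p', q', h'⟩ := hg
    refine ⟨p + p', q + q', ?_⟩
    convert add_mem h h' using 1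
    rw [map_add, map_add]
    ring
  | mul_X f x hf =>
    obtain ⟨p, q, h⟩ := hf
    cases x with
    | s =>
      refine ⟨p * X 0, q * X 0, ?_⟩
      convert Ideal.mul_mem_right (X s) _ h using 1
      have h0 : ofBounds K n (X 0) = X s := by simp [ofBounds]
      rw [map_mul, map_mul, h0]
      ring
    | t =>
      refine ⟨p * X 1, q * X 1, ?_⟩
      convert Ideal.mul_mem_right (X t) _ h using 1
      have h1 : ofBounds K n (X 1) = X t := by simp [ofBounds]
      rw [map_mul, map_mul, h1]
      ring
    | a i' j' =>
      -- After multiplication by x_s x_t, every chain variable may be replaced by x_a, a = `a i j`,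
      -- and x_a² by x_a x_c, hence by x_s x_t, with c on another chain. So (p + x_a q) x_a becomes
      -- x_s x_t q + x_a p.
      refine ⟨q * (X 0 * X 1), p, ?_⟩
      obtain ⟨l, hl, -⟩ := Fin.exists_ne_and_ne hk i i
      have h1 := mul_X_a_sub_X_a_mem (K := K) hk hn i' i j' j
      have h2 := mul_X_a_sub_X_a_mem (K := K) hk hn i l j ⟨0, hn l⟩
      have h3 := X_a_mul_X_a_sub_mem (K := K) hl.symm j ⟨0, hn l⟩
      have h01 : ofBounds K n (X 0 * X 1) = X s * X t := by simp [ofBounds]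
      convert add_mem (add_mem (Ideal.mul_mem_right (X (a i' j')) _ h)
        (Ideal.mul_mem_left _ (ofBounds K n p + X (a i j) * ofBounds K n q) h1))
        (add_mem (Ideal.mul_mem_left _ (X (a i j) * ofBounds K n q) h2)
          (Ideal.mul_mem_left _ (X s * X t * ofBounds K n q) h3)) using 1
      rw [map_mul, h01]
      ring

/-- In the normal form p + x_a q of f, `param` sends p and q to polynomials in the squares and x_a
to `X 0 * X 1`, so by parity p = q = 0. -/
theorem mul_mem_of_param_eq_zero (hk : 3 ≤ k) (hn : ∀ i, 0 < n i)
    {f : MvPolynomial (ChainLattice n) K} (hf : param K n f = 0) :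
    X s * X t * f ∈ joinMeetIdeal K (ChainLattice n) := by
  let i : Fin k := ⟨0, by omega⟩
  obtain ⟨p, q, h⟩ := exists_normal_form hk hn i ⟨0, hn i⟩ f
  have h0 := eq_zero_of_param_mul_eq_zero (param_eq_zero_of_mem h)
  rw [map_sub, hf, map_add, map_mul, param_X_a, param_ofBounds, param_ofBounds, zero_sub,
    neg_eq_zero, mul_assoc] at h0
  obtain ⟨rfl, rfl⟩ := eq_zero_of_expand_two_add_eq_zero h0
  simpa using h

/-! ### The components where x_s x_t vanishes -/

/-- All variables of the chains other than the `i`-th one, together with the variable of `b`. -/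
def offChain (b : ChainLattice n) (i : Fin k) : Set (ChainLattice n) :=
  {x | x = b ∨ ∃ i' j, i' ≠ i ∧ x = a i' j}

/-- Of two elements on different chains, at least one lies off chain i; and b kills x_s x_t. -/
theorem killVars_offChain_eq_zero_of_mem {b : ChainLattice n} (hb : b = s ∨ b = t) (i : Fin k)
    {f : MvPolynomial (ChainLattice n) K} (hf : f ∈ joinMeetIdeal K (ChainLattice n)) :
    killVars K (offChain b i) f = 0 := by
  refine joinMeetIdeal_le (J := RingHom.ker (killVars K (offChain b i)))
    (fun i₁ i₂ j₁ j₂ h => ?_) hf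
  have hst : killVars K (offChain b i) (X s * X t) = 0 := by
    have hb' : killVars K (offChain b i) (X b) = 0 := killVars_X_of_mem (Or.inl rfl)
    rcases hb with rfl | rfl <;> rw [map_mul, hb'] <;> simp
  rw [RingHom.mem_ker, map_sub, hst, sub_zero, map_mul]
  by_cases h₁ : i₁ = i
  · rw [killVars_X_of_mem (x := a i₂ j₂) (Or.inr ⟨i₂, j₂, fun h₂ => h (h₁.trans h₂.symm), rfl⟩),
      mul_zero]
  · rw [killVars_X_of_mem (x := a i₁ j₁) (Or.inr ⟨i₁, j₁, h₁, rfl⟩), zero_mul]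

theorem monomial_mem_of_ne_zero {I : Ideal (MvPolynomial (ChainLattice n) K)}
    {x y : ChainLattice n} (hxy : x ≠ y) (hI : X x * X y ∈ I) {m : ChainLattice n →₀ ℕ}
    (hx : m x ≠ 0) (hy : m y ≠ 0) (c : K) : monomial m c ∈ I := by
  classical
  refine Ideal.mem_of_dvd _ ?_ hI
  rw [X, X, monomial_mul, one_mul, monomial_dvd_monomial]
  refine ⟨Or.inr fun z => ?_, one_dvd c⟩
  rw [Finsupp.add_apply, Finsupp.single_apply, Finsupp.single_apply]
  split_ifs <;> grind

/-- Adding x_s x_t makes the ideal monomial, so single monomials of f can be checked. One that omits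
b = s or t must, for every i, contain a variable off chain i. Using this twice gives variables from
two different chains, whose product is in the ideal. -/
theorem mem_sup_of_killVars_eq_zero (hk : 0 < k) {f : MvPolynomial (ChainLattice n) K}
    (hf : ∀ b : ChainLattice n, b = s ∨ b = t → ∀ i, killVars K (offChain b i) f = 0) :
    f ∈ joinMeetIdeal K (ChainLattice n) ⊔ Ideal.span {X s * X t} := by
  set J := joinMeetIdeal K (ChainLattice n) ⊔ Ideal.span {X s * X t}
  have hst : (X s * X t : MvPolynomial (ChainLattice n) K) ∈ J :=
    Ideal.mem_sup_right (Ideal.mem_span_singleton_self _)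
  rw [f.as_sum]
  refine sum_mem fun m hm => ?_
  by_cases hs : m s ≠ 0 ∧ m t ≠ 0
  · exact monomial_mem_of_ne_zero (by simp) hst hs.1 hs.2 _
  obtain ⟨b, hb, hb0⟩ : ∃ b : ChainLattice n, (b = s ∨ b = t) ∧ m b = 0 := by
    by_cases h : m s = 0
    · exact ⟨s, Or.inl rfl, h⟩
    · exact ⟨t, Or.inr rfl, by tauto⟩
  have key (i : Fin k) : ∃ i' j, i' ≠ i ∧ m (a i' j) ≠ 0 := by
    obtain ⟨x, rfl | ⟨i', j, hi, rfl⟩, hx⟩ :=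
      exists_mem_ne_zero_of_killVars_eq_zero (hf b hb i) hm
    · exact absurd hb0 hx
    · exact ⟨i', j, hi, hx⟩
  obtain ⟨i₁, j₁, -, h₁⟩ := key ⟨0, hk⟩
  obtain ⟨i₂, j₂, hi, h₂⟩ := key i₁
  refine monomial_mem_of_ne_zero (x := a i₂ j₂) (y := a i₁ j₁) (by simp [hi]) ?_ h₂ h₁ _
  simpa using add_mem (Ideal.mem_sup_left (X_a_mul_X_a_sub_mem hi j₂ j₁)) hst

/-- The join-meet ideal of `L_k(n_1, …, n_k)` with at least three nonempty chains is radical. -/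
theorem isRadical_joinMeetIdeal (hk : 3 ≤ k) (hn : ∀ i, 0 < n i) :
    (joinMeetIdeal K (ChainLattice n)).IsRadical := by
  rintro f ⟨m, hm⟩
  have hparam : param K n f = 0 :=
    eq_zero_of_pow_eq_zero (n := m) (by rw [← map_pow]; exact param_eq_zero_of_mem hm)
  have hkill (b : ChainLattice n) (hb : b = s ∨ b = t) (i : Fin k) :
      killVars K (offChain b i) f = 0 :=
    eq_zero_of_pow_eq_zero (n := m)
      (by rw [← map_pow]; exact killVars_offChain_eq_zero_of_mem hb i hm)
  obtain ⟨g, hg, h, hh, rfl⟩ := Submodule.mem_sup.mp (mem_sup_of_killVars_eq_zero (by omega) hkill)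
  obtain ⟨h, rfl⟩ := Ideal.mem_span_singleton.mp hh
  rw [map_add, param_eq_zero_of_mem hg, zero_add] at hparam
  exact add_mem hg (mul_mem_of_param_eq_zero hk hn (eq_zero_of_param_mul_eq_zero hparam))

end ChainLattice

theorem theorem2 {K : Type*} [Field K] (n₁ n₂ n₃ : ℕ)
    (h : ((2 ≤ n₁ ∧ n₁ ≤ 10) ∧ n₂ = 1 ∧ n₃ = 1) ∨
      ((2 ≤ n₁ ∧ n₁ ≤ 4) ∧ (2 ≤ n₂ ∧ n₂ ≤ 4) ∧ n₃ = 1) ∨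
      ((2 ≤ n₁ ∧ n₁ ≤ 3) ∧ (2 ≤ n₂ ∧ n₂ ≤ 3) ∧ (2 ≤ n₃ ∧ n₃ ≤ 3))) :
    (joinMeetIdeal K (ChainLattice ![n₁, n₂, n₃])).IsRadical := by
  refine ChainLattice.isRadical_joinMeetIdeal le_rfl fun i => ?_
  fin_cases i <;> simp <;> omega
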